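/- Let $A\in\mathbb{C}^{n\times n}$ have minimal polynomial $m_A$ of degree $l$ and spectrum $\sigma(A)$. For $u,v\in\mathbb{C}^n$ put $B(\tau)=A+\tau uv^*$, $Q(\lambda)=v^*(\lambda I_n-A)^{-1}u$, and let $p_{uv}$ be the polynomial $p_{uv}(\lambda)=m_A(\lambda)Q(\lambda)$. An eigenvalue of $A$ is called structurally frozen if it is a zero of the polynomial $\det(\lambda I_n-A)/m_A(\lambda)$, and accidentally frozen (by $u,v$) if it is a common zero of $m_A$ and $p_{uv}$. Let $\Gamma=\{e^{i\theta}:\theta\in(0,2\pi)\}$. Say that $(A,u,v)$ has *global angular eigenvalues* if the following holds: (i) The eigenvalues of $B(\tau)$, $\tau\in\Gamma$, which are not eigenvalues of $A$ (listed with algebraic multiplicities) can be defined as $l$ continuous functions $\lambda_1(\tau),\dots,\lambda_l(\tau)$ of $\tau\in\Gamma$, and these are unique up to ordering. (ii) For each $\tau\in\Gamma$ the remaining part of the spectrum of $B(\tau)$ is the set of structurally frozen eigenvalues of $A$, and there are no accidentally frozen eigenvalues. (iii) For $i,j=1,\dots,l$, $i\ne j$, one has $\lambda_i(\tau)\ne\lambda_j(\tilde\tau)$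 for all $\tau,\tilde\tau\in\Gamma$. (iv) The functions $\lambda_j$ can be extended to analytic functions in some open complex neighbourhood of $\Gamma$. Say that $(A,u,v)$ satisfies the *generic condition* if there are no accidentally frozen eigenvalues and $|Q(z)|\ne 1$ for every zero $z$ of $Q'$. Then, for every $n$ and every $A\in\mathbb{C}^{n\times n}$: (a) If $(A,u,v)$ satisfies the generic condition, then it has global angular eigenvalues. (b) Conversely, if $(A,u,v)$ has global angular eigenvalues, then there are no accidentally frozen eigenvalues, and $|Q(z)|\neq 1$ for every zero $z$ of $Q'$ with $Q(z)\ne 1$. (c) Let $u\in\mathbb{C}^n$ be such that every polynomial $q$ with $q(A)u=0$ is divisible by $m_A$. Then for all $v\in\mathbb{C}^n$ except some closed set with empty interior, $(A,u,v)$ satisfies the generic condition and has global angular eigenvalues. (d) The requirement on $u$ in (c) is satisfied by all $u\in\mathbb{C}^n$ except some closed set with empty interior. (e) For all $(u,v)\in\mathbb{C}^n\times\mathbb{C}^n$ except some closed set with empty interior, $(A,u,v)$ satisfies the generic condition and has global angular eigenvalues. -/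

import Mathlib

namespace RankOnePerturbation

variable {n : ℕ}

/-- The rank one perturbation `B(τ) = A + τ u v^*`. -/
noncomputable def pert (A : Matrix (Fin n) (Fin n) ℂ) (u v : Fin n → ℂ) (τ : ℂ) :
    Matrix (Fin n) (Fin n) ℂ :=
  A + τ • Matrix.vecMulVec u (star v)

/-- The function `Q(z) = v^* (z I - A)⁻¹ u`; meaningful for `z` outside the spectrum of `A`. -/
noncomputable def Q (A : Matrix (Fin n) (Fin n) ℂ) (u v : Fin n → ℂ) (z : ℂ) : ℂ :=
  star v ⬝ᵥ Matrix.mulVec ((z • (1 : Matrix (Fin n) (Fin n) ℂ) - A)⁻¹) u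

/-- The polynomial `p_{uv}(z) = v^* m_A(z) (z I - A)⁻¹ u`, where `m_A = ∑ c_k X^k` is the minimal
polynomial of `A`. It is written through
`m_A(z) I = m_A(z) I - m_A(A) = (z I - A) ∑_k c_k ∑_{i < k} z^i A^(k-1-i)`;
see `pPoly_eval` for the agreement with the first formula. -/
noncomputable def pPoly (A : Matrix (Fin n) (Fin n) ℂ) (u v : Fin n → ℂ) : Polynomial ℂ :=
  ∑ k ∈ Finset.range ((minpoly ℂ A).natDegree + 1), ∑ i ∈ Finset.range k,
    Polynomial.C ((minpoly ℂ A).coeff k * (star v ⬝ᵥ Matrix.mulVec (A ^ (k - 1 - i)) u)) *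
      Polynomial.X ^ i

theorem pPoly_eval (A : Matrix (Fin n) (Fin n) ℂ) (u v : Fin n → ℂ) (z : ℂ)
    (hz : z ∉ spectrum ℂ A) :
    (pPoly A u v).eval z = (minpoly ℂ A).eval z * Q A u v z := by
  set m := minpoly ℂ A with hm
  set R : Matrix (Fin n) (Fin n) ℂ := z • (1 : Matrix (Fin n) (Fin n) ℂ) - A with hR
  have hu : IsUnit R := by
    have h := spectrum.notMem_iff.mp hz
    rwa [Algebra.algebraMap_eq_smul_one] at h
  have hdet : IsUnit R.det := (Matrix.isUnit_iff_isUnit_det R).mp hu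
  set S : Matrix (Fin n) (Fin n) ℂ := ∑ k ∈ Finset.range (m.natDegree + 1),
    m.coeff k • ∑ i ∈ Finset.range k, z ^ i • A ^ (k - 1 - i) with hS
  have hcomm : Commute (z • (1 : Matrix (Fin n) (Fin n) ℂ)) A :=
    (Commute.one_left A).smul_left z
  have hgeom : ∀ k : ℕ, R * ∑ i ∈ Finset.range k, z ^ i • A ^ (k - 1 - i)
      = z ^ k • (1 : Matrix (Fin n) (Fin n) ℂ) - A ^ k := by
    intro k
    have h := hcomm.mul_geom_sum₂ k
    simpa [smul_pow] using h
  have hRS : R * S = m.eval z • (1 : Matrix (Fin n) (Fin n) ℂ) := by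
    have h0 : Polynomial.aeval A m = 0 := minpoly.aeval ℂ A
    rw [Polynomial.aeval_eq_sum_range] at h0
    rw [hS, Finset.mul_sum, Polynomial.eval_eq_sum_range, Finset.sum_smul]
    simp_rw [Matrix.mul_smul, hgeom, smul_sub, Finset.sum_sub_distrib, h0, sub_zero, smul_smul]
  have hS2 : S = m.eval z • R⁻¹ := by
    have h : R⁻¹ * (R * S) = S := Matrix.nonsing_inv_mul_cancel_left R S hdet
    rw [← h, hRS, Matrix.mul_smul, mul_one]
  have hlhs : (pPoly A u v).eval z = star v ⬝ᵥ Matrix.mulVec S u := by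
    rw [hS]
    simp only [pPoly, Polynomial.eval_finsetSum, Polynomial.eval_mul, Polynomial.eval_C,
      Polynomial.eval_pow, Polynomial.eval_X, Matrix.sum_mulVec, dotProduct_sum,
      Matrix.smul_mulVec, dotProduct_smul, smul_eq_mul, Finset.mul_sum]
    refine Finset.sum_congr rfl fun k _ => Finset.sum_congr rfl fun i _ => ?_
    ring
  rw [hlhs, hS2, Matrix.smul_mulVec, dotProduct_smul, smul_eq_mul, Q]

/-- `z` is structurally frozen: a zero of the polynomial `det(z I - A) / m_A(z)`
(the division is exact, see `charpoly_eq`). -/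
def StructurallyFrozen (A : Matrix (Fin n) (Fin n) ℂ) (z : ℂ) : Prop :=
  (A.charpoly /ₘ minpoly ℂ A).IsRoot z

theorem charpoly_eq (A : Matrix (Fin n) (Fin n) ℂ) :
    minpoly ℂ A * (A.charpoly /ₘ minpoly ℂ A) = A.charpoly := by
  have hm : (minpoly ℂ A).Monic := minpoly.monic (Matrix.isIntegral A)
  have h := Polynomial.modByMonic_add_div A.charpoly (minpoly ℂ A)
  rwa [(Polynomial.modByMonic_eq_zero_iff_dvd hm).mpr (Matrix.minpoly_dvd_charpoly A),
    zero_add] at h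

/-- `z` is an accidentally frozen eigenvalue of `A`: a common zero of `m_A` and `p_{uv}`. -/
def AccidentallyFrozen (A : Matrix (Fin n) (Fin n) ℂ) (u v : Fin n → ℂ) (z : ℂ) : Prop :=
  (minpoly ℂ A).IsRoot z ∧ (pPoly A u v).IsRoot z

/-- `z` is a zero of `Q'`. (If there are no accidentally frozen eigenvalues, then every eigenvalue
of `A` is a pole of the rational function `Q`, hence of `Q'`, so all zeros of the rational function
`Q'` lie outside the spectrum of `A`.) -/
def IsCriticalPoint (A : Matrix (Fin n) (Fin n) ℂ) (u v : Fin n → ℂ) (z : ℂ) : Prop :=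
  z ∉ spectrum ℂ A ∧ deriv (Q A u v) z = 0

/-- The generic condition: no accidentally frozen eigenvalues, and `|Q(z)| ≠ 1` at the zeros
`z` of `Q'`. -/
def GenericCondition (A : Matrix (Fin n) (Fin n) ℂ) (u v : Fin n → ℂ) : Prop :=
  (∀ z : ℂ, ¬ AccidentallyFrozen A u v z) ∧
    ∀ z : ℂ, IsCriticalPoint A u v z → ‖Q A u v z‖ ≠ 1

/-- The range of the angular parameter: all `τ = e^{iθ}` with `θ ∈ (0, 2π)`. -/
def arc : Set ℂ :=
  {τ | ∃ θ ∈ Set.Ioo (0 : ℝ) (2 * Real.pi), τ = Complex.exp ((θ : ℂ) * Complex.I)}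

open Classical in
/-- The eigenvalues of `B`, with algebraic multiplicities, that are not eigenvalues of `A`. -/
noncomputable def newEigenvalues (A B : Matrix (Fin n) (Fin n) ℂ) : Multiset ℂ :=
  B.charpoly.roots.filter (fun z => z ∉ spectrum ℂ A)

/-- The functions `lam 1, …, lam l` are continuous on the arc and list, for each `τ` in the arc,
the eigenvalues of `B(τ)` (with algebraic multiplicities) that are not eigenvalues of `A`. -/
def IsEigenvalueFamily (A : Matrix (Fin n) (Fin n) ℂ) (u v : Fin n → ℂ) {l : ℕ}
    (lam : Fin l → ℂ → ℂ) : Prop :=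
  (∀ j, ContinuousOn (lam j) arc) ∧
    ∀ τ ∈ arc, newEigenvalues A (pert A u v τ) =
      Multiset.map (fun j => lam j τ) (Finset.univ : Finset (Fin l)).val

/-- The conclusions on global eigenvalue functions for the angular parameter. -/
def GlobalAngularEigenvalues (A : Matrix (Fin n) (Fin n) ℂ) (u v : Fin n → ℂ) : Prop :=
  ∃ lam : Fin (minpoly ℂ A).natDegree → ℂ → ℂ,
    -- existence, and uniqueness up to ordering
    IsEigenvalueFamily A u v lam ∧
    (∀ lam' : Fin (minpoly ℂ A).natDegree → ℂ → ℂ, IsEigenvalueFamily A u v lam' →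
      ∃ s : Equiv.Perm (Fin (minpoly ℂ A).natDegree),
        ∀ j, ∀ τ ∈ arc, lam' j τ = lam (s j) τ) ∧
    -- the rest of the spectrum consists of the structurally frozen eigenvalues
    (∀ τ ∈ arc, spectrum ℂ (pert A u v τ) \ {z | ∃ j, lam j τ = z} =
      {z | StructurallyFrozen A z}) ∧
    (∀ z : ℂ, ¬ AccidentallyFrozen A u v z) ∧
    -- different eigenvalue functions never meet, even at different parameters
    (∀ i j, i ≠ j → ∀ τ ∈ arc, ∀ τ' ∈ arc, lam i τ ≠ lam j τ') ∧
    -- analytic extension to an open complex neighbourhood of the arc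
    (∃ U : Set ℂ, IsOpen U ∧ arc ⊆ U ∧ ∃ g : Fin (minpoly ℂ A).natDegree → ℂ → ℂ,
      ∀ j, AnalyticOnNhd ℂ (g j) U ∧ Set.EqOn (g j) (lam j) arc)

/-- The minimal polynomial of the vector `u` relative to `A` is the minimal polynomial of `A`. -/
def HasFullMinpoly (A : Matrix (Fin n) (Fin n) ℂ) (u : Fin n → ℂ) : Prop :=
  ∀ q : Polynomial ℂ, Matrix.mulVec (Polynomial.aeval A q) u = 0 → minpoly ℂ A ∣ q

end RankOnePerturbation

namespace RankOnePerturbation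

open Polynomial

variable {n : ℕ}

/-! Write m for the minimal polynomial of A and p for `pPoly`. The determinant lemma gives det(z -
B(τ)) = (det(z - A)/m)(m - τp), so without accidental freezing the new eigenvalues are the zeros of
m - τp, that is, the fibre over τ of the rational function m/p = 1/Q. Where m = τp and p is nonzero,
the zero is multiple exactly when the Wronskian of m and p vanishes.

For (a): since deg p < deg m, the map m/p is closed, and over the regular values it is a finite
covering (`isCoveringMapOn_div`). The generic condition makes the whole unit circle regular. In a
logarithmic coordinate the circle acquires a convex, hence simply connected, neighbourhood, and
lifting through the covering gives holomorphic branches (`exists_branch`). They cannot meet at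
different parameters because the value of m/p at a point determines τ.

For (b): a critical point with |Q| = 1 and Q ≠ 1 is a double zero of m - τp for τ = 1/Q on the arc,
so two branches would meet.

For (c)-(e): the failure of the generic condition is the projection of a closed set with locally
bounded fibres, hence closed. It has empty interior because small changes of v remove accidental
freezing, and then a real rescaling of v avoids the finitely many critical moduli. -/

/-! ### The minimal polynomial and p at the eigenvalues of A -/

theorem mem_spectrum_iff_isRoot_minpoly (A : Matrix (Fin n) (Fin n) ℂ) (z : ℂ) :
    z ∈ spectrum ℂ A ↔ (minpoly ℂ A).IsRoot z := by
  rw [← Matrix.spectrum_toLin', ← Module.End.hasEigenvalue_iff_mem_spectrum,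
    Module.End.hasEigenvalue_iff_isRoot, Matrix.minpoly_toLin']

theorem minpoly_monic (A : Matrix (Fin n) (Fin n) ℂ) : (minpoly ℂ A).Monic :=
  minpoly.monic (Matrix.isIntegral A)

theorem infinite_compl_spectrum (A : Matrix (Fin n) (Fin n) ℂ) : (spectrum ℂ A)ᶜ.Infinite := by
  refine Set.Finite.infinite_compl ?_
  refine ((minpoly ℂ A).rootSet_finite ℂ).subset fun z hz => ?_
  rw [mem_rootSet]
  refine ⟨(minpoly_monic A).ne_zero, ?_⟩
  simpa using (mem_spectrum_iff_isRoot_minpoly A z).1 hz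

/-- The coefficients of `pPoly`. -/
theorem pPoly_coeff (A : Matrix (Fin n) (Fin n) ℂ) (u v : Fin n → ℂ) (i : ℕ) :
    (pPoly A u v).coeff i = ∑ k ∈ Finset.range ((minpoly ℂ A).natDegree + 1),
      if i < k then (minpoly ℂ A).coeff k * (star v ⬝ᵥ Matrix.mulVec (A ^ (k - 1 - i)) u)
      else 0 := by
  simp only [pPoly, finsetSum_coeff, coeff_C_mul, coeff_X_pow, mul_ite, mul_one, mul_zero,
    Finset.sum_ite_eq, Finset.mem_range]

theorem pPoly_degree_lt (A : Matrix (Fin n) (Fin n) ℂ) (u v : Fin n → ℂ) :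
    (pPoly A u v).degree < (minpoly ℂ A).natDegree := by
  rw [degree_lt_iff_coeff_zero]
  intro i hi
  rw [pPoly_coeff]
  refine Finset.sum_eq_zero fun k hk => if_neg ?_
  rw [Finset.mem_range] at hk
  omega

/-- The matrix `m_A(A) / (A - z)`, for a zero `z` of the minimal polynomial `m_A`. -/
noncomputable def cofactorAt (A : Matrix (Fin n) (Fin n) ℂ) (z : ℂ) : Matrix (Fin n) (Fin n) ℂ :=
  aeval A (minpoly ℂ A /ₘ (X - C z))

theorem divByMonic_eq_sum_of_isRoot {m : ℂ[X]} {z : ℂ} (hz : m.IsRoot z) :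
    m /ₘ (X - C z) = ∑ k ∈ Finset.range (m.natDegree + 1), ∑ i ∈ Finset.range k,
      C (m.coeff k) * (C z ^ i * X ^ (k - 1 - i)) := by
  have hne : (X - C z : ℂ[X]) ≠ 0 := X_sub_C_ne_zero z
  refine mul_left_cancel₀ hne ?_
  rw [mul_divByMonic_eq_iff_isRoot.2 hz, Finset.mul_sum]
  -- Each inner sum telescopes to X^k - z^k, so the total is m - m(z) = m.
  have h1 : ∀ k, (X - C z) * ∑ i ∈ Finset.range k, C (m.coeff k) * (C z ^ i * X ^ (k - 1 - i))
      = C (m.coeff k) * X ^ k - C (m.coeff k * z ^ k) := by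
    intro k
    have h := (Commute.all (C z) (X : ℂ[X])).mul_geom_sum₂ k
    rw [← Finset.mul_sum, mul_left_comm, ← neg_sub (C z) X, neg_mul, h, map_mul, map_pow]
    ring
  simp_rw [h1, Finset.sum_sub_distrib, ← map_sum]
  rw [← eval_eq_sum_range, hz.eq_zero, map_zero, sub_zero]
  exact as_sum_range_C_mul_X_pow m

/-- At an eigenvalue the resolvent is unavailable, but (m(z) - m(A))/(z - A) still makes sense and
becomes m(A)/(A - z). Accidental freezing is thereby a sesquilinear equation in u and v. -/
theorem eval_pPoly_of_isRoot (A : Matrix (Fin n) (Fin n) ℂ) (u v : Fin n → ℂ) {z : ℂ}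
    (hz : (minpoly ℂ A).IsRoot z) :
    (pPoly A u v).eval z = star v ⬝ᵥ Matrix.mulVec (cofactorAt A z) u := by
  rw [cofactorAt, divByMonic_eq_sum_of_isRoot hz]
  simp only [pPoly, eval_finsetSum, eval_smul, eval_pow, eval_X, map_sum, ← C_pow,
    ← smul_eq_C_mul, map_smul, map_pow (aeval A), aeval_X, Matrix.sum_mulVec, dotProduct_sum,
    Matrix.smul_mulVec, dotProduct_smul, smul_eq_mul]
  refine Finset.sum_congr rfl fun k _ => Finset.sum_congr rfl fun i _ => ?_
  ring

/-- The annihilator of u is an ideal containing m. If it is larger than (m), it contains a proper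
divisor of m, hence some m/(X - z); this leaves finitely many linear conditions to check. -/
theorem hasFullMinpoly_iff (A : Matrix (Fin n) (Fin n) ℂ) (u : Fin n → ℂ) :
    HasFullMinpoly A u ↔
      ∀ z, (minpoly ℂ A).IsRoot z → Matrix.mulVec (cofactorAt A z) u ≠ 0 := by
  have hm := minpoly_monic A
  constructor
  · intro h z hz h0
    have hd := h _ h0
    have hmul := mul_divByMonic_eq_iff_isRoot.2 hz
    set q := minpoly ℂ A /ₘ (X - C z)
    have hq : q ≠ 0 := by
      rintro hq
      rw [hq, mul_zero] at hmul
      exact hm.ne_zero hmul.symm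
    have h1 := natDegree_le_of_dvd hd hq
    rw [← hmul, natDegree_mul (X_sub_C_ne_zero z) hq, natDegree_X_sub_C] at h1
    omega
  · intro h q hq
    set g := EuclideanDomain.gcd q (minpoly ℂ A) with hg
    have hgu : Matrix.mulVec (aeval A g) u = 0 := by
      rw [hg, EuclideanDomain.gcd_eq_gcd_ab, map_add, map_mul, map_mul, minpoly.aeval, zero_mul,
        add_zero, ← map_mul, mul_comm, map_mul, ← Matrix.mulVec_mulVec, hq, Matrix.mulVec_zero]
    obtain ⟨r, hr⟩ := EuclideanDomain.gcd_dvd_right q (minpoly ℂ A)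
    rw [← hg] at hr
    by_cases hu : IsUnit r
    · rw [hr, hu.mul_right_dvd]
      exact EuclideanDomain.gcd_dvd_left q _
    · exfalso
      have hr0 : r ≠ 0 := by
        rintro rfl
        exact hm.ne_zero (by rw [hr, mul_zero])
      obtain ⟨z, hz⟩ := IsAlgClosed.exists_root r fun h0 => hu ((isUnit_iff_degree_eq_zero).2 h0)
      obtain ⟨s, hs⟩ := dvd_iff_isRoot.2 hz
      have hroot : (minpoly ℂ A).IsRoot z := hz.dvd ⟨g, by rw [hr, mul_comm]⟩
      refine h z hroot ?_
      have : minpoly ℂ A /ₘ (X - C z) = s * g := by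
        refine mul_left_cancel₀ (X_sub_C_ne_zero z) ?_
        rw [mul_divByMonic_eq_iff_isRoot.2 hroot, hr, hs]
        ring
      rw [cofactorAt, this, map_mul, ← Matrix.mulVec_mulVec, hgu, Matrix.mulVec_zero]

theorem cofactorAt_ne_zero (A : Matrix (Fin n) (Fin n) ℂ) {z : ℂ} (hz : (minpoly ℂ A).IsRoot z) :
    cofactorAt A z ≠ 0 := by
  intro h0
  have hm := minpoly_monic A
  have hd := minpoly.dvd ℂ A h0
  have hmul := mul_divByMonic_eq_iff_isRoot.2 hz
  set q := minpoly ℂ A /ₘ (X - C z)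
  have hq : q ≠ 0 := by
    rintro hq
    rw [hq, mul_zero] at hmul
    exact hm.ne_zero hmul.symm
  have h1 := natDegree_le_of_dvd hd hq
  rw [← hmul, natDegree_mul (X_sub_C_ne_zero z) hq, natDegree_X_sub_C] at h1
  omega

/-! ### The characteristic polynomial of B(τ) and its new eigenvalues -/

theorem det_smul_one_sub_pert (A : Matrix (Fin n) (Fin n) ℂ) (u v : Fin n → ℂ) (τ : ℂ) {z : ℂ}
    (hz : z ∉ spectrum ℂ A) :
    (z • (1 : Matrix (Fin n) (Fin n) ℂ) - pert A u v τ).det =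
      (z • (1 : Matrix (Fin n) (Fin n) ℂ) - A).det * (1 - τ * Q A u v z) := by
  have hdet : IsUnit (z • (1 : Matrix (Fin n) (Fin n) ℂ) - A).det := by
    have h := spectrum.notMem_iff.mp hz
    rw [Algebra.algebraMap_eq_smul_one] at h
    exact (Matrix.isUnit_iff_isUnit_det _).mp h
  have h : z • (1 : Matrix (Fin n) (Fin n) ℂ) - pert A u v τ = (z • 1 - A) +
      Matrix.replicateCol Unit (-τ • u) * Matrix.replicateRow Unit (star v) := by
    rw [pert, ← Matrix.vecMulVec_eq, Matrix.smul_vecMulVec, neg_smul]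
    abel
  rw [h, Matrix.det_add_mul _ _ hdet]
  congr 1
  rw [Q, Matrix.mul_assoc, ← Matrix.replicateCol_mulVec, Matrix.det_unique (n := Unit),
    Matrix.add_apply, Matrix.one_apply_eq, Matrix.replicateRow_mul_replicateCol_apply,
    Matrix.mulVec_smul, dotProduct_smul, smul_eq_mul]
  ring

theorem eval_charpoly_eq_det (M : Matrix (Fin n) (Fin n) ℂ) (z : ℂ) :
    M.charpoly.eval z = (z • (1 : Matrix (Fin n) (Fin n) ℂ) - M).det := by
  rw [Matrix.eval_charpoly, Matrix.scalar_apply, Matrix.smul_one_eq_diagonal]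

theorem charpoly_pert (A : Matrix (Fin n) (Fin n) ℂ) (u v : Fin n → ℂ) (τ : ℂ) :
    (pert A u v τ).charpoly =
      (A.charpoly /ₘ minpoly ℂ A) * (minpoly ℂ A - C τ * pPoly A u v) := by
  -- Off the spectrum the identity is the determinant lemma; infinitely many points suffice for
  -- polynomials.
  refine eq_of_infinite_eval_eq _ _ ((infinite_compl_spectrum A).mono fun z hz => ?_)
  have h := congrArg (eval z) (charpoly_eq A)
  simp only [eval_mul] at h
  simp only [Set.mem_ofPred_eq, eval_mul, eval_sub, eval_C, pPoly_eval A u v z hz,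
    eval_charpoly_eq_det, det_smul_one_sub_pert A u v τ hz]
  rw [← eval_charpoly_eq_det, ← h]
  ring

theorem isRoot_minpoly_of_structurallyFrozen {A : Matrix (Fin n) (Fin n) ℂ} {z : ℂ}
    (hz : StructurallyFrozen A z) : (minpoly ℂ A).IsRoot z := by
  rw [← mem_spectrum_iff_isRoot_minpoly, Matrix.mem_spectrum_iff_isRoot_charpoly]
  exact IsRoot.dvd hz ⟨minpoly ℂ A, by rw [mul_comm, charpoly_eq]⟩

theorem minpoly_sub_degree (A : Matrix (Fin n) (Fin n) ℂ) (u v : Fin n → ℂ) (τ : ℂ) :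
    (minpoly ℂ A - C τ * pPoly A u v).Monic ∧
      (minpoly ℂ A - C τ * pPoly A u v).natDegree = (minpoly ℂ A).natDegree := by
  have hlt : (C τ * pPoly A u v).degree < (minpoly ℂ A).degree := by
    rw [degree_eq_natDegree (minpoly_monic A).ne_zero]
    refine lt_of_le_of_lt ?_ (pPoly_degree_lt A u v)
    rw [← smul_eq_C_mul]
    exact degree_smul_le _ _
  exact ⟨(minpoly_monic A).sub_of_left hlt, natDegree_eq_of_degree_eq (degree_sub_eq_left_of_degree_lt hlt)⟩

open Classical in
theorem newEigenvalues_pert {A : Matrix (Fin n) (Fin n) ℂ} {u v : Fin n → ℂ}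
    (hfr : ∀ z, ¬ AccidentallyFrozen A u v z) {τ : ℂ} (hτ : τ ≠ 0) :
    newEigenvalues A (pert A u v τ) = (minpoly ℂ A - C τ * pPoly A u v).roots := by
  have hne : (A.charpoly /ₘ minpoly ℂ A) * (minpoly ℂ A - C τ * pPoly A u v) ≠ 0 := by
    rw [← charpoly_pert]
    exact (Matrix.charpoly_monic _).ne_zero
  rw [newEigenvalues, charpoly_pert, roots_mul hne, Multiset.filter_add,
    (Multiset.filter_eq_nil (p := fun z => z ∉ spectrum ℂ A)).2, zero_add,
    Multiset.filter_eq_self]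
  · intro z hz hs
    rw [mem_spectrum_iff_isRoot_minpoly] at hs
    refine hfr z ⟨hs, ?_⟩
    have h := (mem_roots (right_ne_zero_of_mul hne)).1 hz
    simpa [IsRoot, hs.eq_zero, hτ] using h
  · intro z hz
    rw [not_not, mem_spectrum_iff_isRoot_minpoly]
    exact isRoot_minpoly_of_structurallyFrozen ((mem_roots (left_ne_zero_of_mul hne)).1 hz)

theorem isRoot_minpoly_sub_iff (A : Matrix (Fin n) (Fin n) ℂ) (u v : Fin n → ℂ) (τ z : ℂ) :
    (minpoly ℂ A - C τ * pPoly A u v).IsRoot z ↔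
      (minpoly ℂ A).eval z = τ * (pPoly A u v).eval z := by
  simp [IsRoot, sub_eq_zero]

/-! ### Critical points of Q through the Wronskian -/

theorem deriv_Q (A : Matrix (Fin n) (Fin n) ℂ) (u v : Fin n → ℂ) {z : ℂ}
    (hz : z ∉ spectrum ℂ A) :
    deriv (Q A u v) z =
      (wronskian (minpoly ℂ A) (pPoly A u v)).eval z / ((minpoly ℂ A).eval z) ^ 2 := by
  have hm : (minpoly ℂ A).eval z ≠ 0 := fun h => hz ((mem_spectrum_iff_isRoot_minpoly A z).2 h)
  have hev : Q A u v =ᶠ[nhds z] fun y => (pPoly A u v).eval y / (minpoly ℂ A).eval y := by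
    have h0 := (minpoly ℂ A).continuous.continuousAt.eventually_ne hm
    filter_upwards [h0] with y hy
    rw [pPoly_eval A u v y fun h => hy ((mem_spectrum_iff_isRoot_minpoly A y).1 h),
      mul_div_cancel_left₀ _ hy]
  rw [hev.deriv_eq]
  refine (((pPoly A u v).hasDerivAt z).div ((minpoly ℂ A).hasDerivAt z) hm).deriv.trans ?_
  simp only [wronskian, eval_sub, eval_mul]
  ring

/-- A common zero of m and p also kills the Wronskian, and off the spectrum |Q| = 1 means |p| = |m|.
Both clauses thus merge into one polynomial condition without poles, which is what continuity
arguments need. -/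
theorem genericCondition_iff (A : Matrix (Fin n) (Fin n) ℂ) (u v : Fin n → ℂ) :
    GenericCondition A u v ↔ ∀ z, (wronskian (minpoly ℂ A) (pPoly A u v)).eval z = 0 →
      ‖(pPoly A u v).eval z‖ ≠ ‖(minpoly ℂ A).eval z‖ := by
  constructor
  · rintro ⟨h1, h2⟩ z hw heq
    by_cases hm : (minpoly ℂ A).eval z = 0
    · rw [hm, norm_zero, norm_eq_zero] at heq
      exact h1 z ⟨hm, heq⟩
    · have hz : z ∉ spectrum ℂ A := fun h => hm ((mem_spectrum_iff_isRoot_minpoly A z).1 h)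
      refine h2 z ⟨hz, by rw [deriv_Q A u v hz, hw, zero_div]⟩ ?_
      rw [pPoly_eval A u v z hz, norm_mul] at heq
      exact mul_left_cancel₀ (norm_ne_zero_iff.2 hm) (by rw [heq, mul_one])
  · intro h
    refine ⟨?_, ?_⟩
    · rintro z ⟨hm, hp⟩
      refine h z ?_ (by rw [hm.eq_zero, hp.eq_zero])
      simp [wronskian, hm.eq_zero, hp.eq_zero]
    · rintro z ⟨hz, hd⟩ h1
      have hm : (minpoly ℂ A).eval z ≠ 0 :=
        fun h => hz ((mem_spectrum_iff_isRoot_minpoly A z).2 h)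
      rw [deriv_Q A u v hz, div_eq_zero_iff, or_iff_left (pow_ne_zero 2 hm)] at hd
      refine h z hd ?_
      rw [pPoly_eval A u v z hz, norm_mul, h1, mul_one]

theorem isCoprime_minpoly_pPoly {A : Matrix (Fin n) (Fin n) ℂ} {u v : Fin n → ℂ}
    (hfr : ∀ z, ¬ AccidentallyFrozen A u v z) : IsCoprime (minpoly ℂ A) (pPoly A u v) := by
  rw [isCoprime_iff_aeval_ne_zero_of_isAlgClosed ℂ ℂ]
  intro z
  by_contra! h
  exact hfr z (by simpa [AccidentallyFrozen, IsRoot] using h)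

theorem wronskian_ne_zero {A : Matrix (Fin n) (Fin n) ℂ} {u v : Fin n → ℂ}
    (hfr : ∀ z, ¬ AccidentallyFrozen A u v z) (hl : (minpoly ℂ A).natDegree ≠ 0) :
    wronskian (minpoly ℂ A) (pPoly A u v) ≠ 0 := fun h =>
  hl (derivative_eq_zero.1 ((isCoprime_minpoly_pPoly hfr).wronskian_eq_zero_iff.1 h).1)

/-! ### The exceptional sets are closed with empty interior -/

theorem eval_eq_sum_range_of_degree_lt {p : ℂ[X]} {l : ℕ} (h : p.degree < l) (z : ℂ) :
    p.eval z = ∑ i ∈ Finset.range l, p.coeff i * z ^ i := by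
  by_cases h0 : p = 0
  · simp [h0]
  · exact eval_eq_sum_range' ((natDegree_lt_iff_degree_lt h0).2 h) z

/-- A bound for the points where a monic polynomial is dominated by lower order terms. -/
theorem norm_le_of_norm_eval_le {m : ℂ[X]} (hm : m.Monic) {c : ℝ} {z : ℂ} (hc : 0 ≤ c)
    (h : ‖m.eval z‖ ≤ c * ∑ i ∈ Finset.range m.natDegree, ‖z‖ ^ i) :
    ‖z‖ ≤ 1 + ∑ i ∈ Finset.range m.natDegree, (‖m.coeff i‖ + c) := by
  have hs : 0 ≤ ∑ i ∈ Finset.range m.natDegree, (‖m.coeff i‖ + c) :=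
    Finset.sum_nonneg fun i _ => by positivity
  by_contra! hlt
  have h1 : 1 ≤ ‖z‖ := by linarith
  have hlead : z ^ m.natDegree =
      m.eval z - ∑ i ∈ Finset.range m.natDegree, m.coeff i * z ^ i := by
    rw [eval_eq_sum_range, Finset.sum_range_succ, hm.coeff_natDegree]
    ring
  have h2 : ‖z‖ ^ m.natDegree ≤ ∑ i ∈ Finset.range m.natDegree, (‖m.coeff i‖ + c) * ‖z‖ ^ i := by
    rw [← norm_pow, hlead]
    refine (norm_sub_le _ _).trans ?_
    simp_rw [add_mul, Finset.sum_add_distrib, ← Finset.mul_sum]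
    rw [add_comm]
    refine add_le_add ((norm_sum_le _ _).trans (le_of_eq ?_)) h
    simp_rw [norm_mul, norm_pow]
  rcases Nat.eq_zero_or_pos m.natDegree with h0 | hpos
  · rw [h0] at h2
    norm_num at h2
  · have h3 : ∑ i ∈ Finset.range m.natDegree, (‖m.coeff i‖ + c) * ‖z‖ ^ i ≤
        (∑ i ∈ Finset.range m.natDegree, (‖m.coeff i‖ + c)) * ‖z‖ ^ (m.natDegree - 1) := by
      rw [Finset.sum_mul]
      refine Finset.sum_le_sum fun i hi => ?_
      rw [Finset.mem_range] at hi
      exact mul_le_mul_of_nonneg_left (pow_le_pow_right₀ h1 (by omega)) (by positivity)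
    have h4 : ‖z‖ ^ m.natDegree = ‖z‖ * ‖z‖ ^ (m.natDegree - 1) := by
      rw [← pow_succ', Nat.sub_add_cancel hpos]
    have h5 : 0 < ‖z‖ ^ (m.natDegree - 1) := by positivity
    have := le_of_mul_le_mul_right (h4 ▸ h2.trans h3) h5
    linarith

/-- The projection along `ℂ` of a closed set with locally bounded fibres is closed. -/
theorem isClosed_exists_of_locally_bounded {X : Type*} [TopologicalSpace X] {S : Set (X × ℂ)}
    (hS : IsClosed S)
    (hb : ∀ x, ∃ R : ℝ, ∀ᶠ y in nhds x, ∀ z, (y, z) ∈ S → ‖z‖ ≤ R) :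
    IsClosed {x | ∃ z, (x, z) ∈ S} := by
  rw [← isOpen_compl_iff, isOpen_iff_mem_nhds]
  intro x hx
  obtain ⟨R, hR⟩ := hb x
  obtain ⟨U, V, hU, -, hxU, hV, hUV⟩ := generalized_tube_lemma (isCompact_singleton (x := x))
    (isCompact_closedBall (0 : ℂ) R) hS.isOpen_compl (by
      rintro ⟨y, z⟩ ⟨hy, -⟩ hyz
      rw [Set.mem_singleton_iff] at hy
      exact hx ⟨z, by rw [← hy]; exact hyz⟩)
  filter_upwards [hR, hU.mem_nhds (hxU rfl)] with y hy hyU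
  rintro ⟨z, hz⟩
  exact hUV (Set.mk_mem_prod hyU (hV (by simpa using hy z hz))) hz

theorem continuous_eval_of_continuous_coeff {X : Type*} [TopologicalSpace X] {P : X → ℂ[X]}
    {l : ℕ} (hd : ∀ x, (P x).degree < l) (hc : ∀ i, Continuous fun x => (P x).coeff i) :
    Continuous fun y : X × ℂ => (P y.1).eval y.2 := by
  simp_rw [fun y : X × ℂ => eval_eq_sum_range_of_degree_lt (hd y.1) y.2]
  exact continuous_finsetSum _ fun i _ => ((hc i).comp continuous_fst).mul (by fun_prop)

theorem continuous_pPoly_coeff (A : Matrix (Fin n) (Fin n) ℂ) (i : ℕ) :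
    Continuous fun x : (Fin n → ℂ) × (Fin n → ℂ) => (pPoly A x.1 x.2).coeff i := by
  simp_rw [pPoly_coeff]
  refine continuous_finsetSum _ fun k _ => ?_
  split_ifs
  · exact continuous_const.mul (Continuous.dotProduct (by fun_prop)
      (Continuous.matrix_mulVec continuous_const continuous_fst))
  · exact continuous_const

theorem isClosed_not_genericCondition (A : Matrix (Fin n) (Fin n) ℂ) :
    IsClosed {x : (Fin n → ℂ) × (Fin n → ℂ) | ¬ GenericCondition A x.1 x.2} := by
  set m := minpoly ℂ A with hm
  set P : (Fin n → ℂ) × (Fin n → ℂ) → ℂ[X] := fun x => pPoly A x.1 x.2 with hP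
  have hPd : ∀ x, (P x).degree < m.natDegree := fun x => pPoly_degree_lt A x.1 x.2
  have hPc : ∀ i, Continuous fun x => (P x).coeff i := continuous_pPoly_coeff A
  have hev := continuous_eval_of_continuous_coeff hPd hPc
  have hdev : Continuous fun y : ((Fin n → ℂ) × (Fin n → ℂ)) × ℂ =>
      (derivative (P y.1)).eval y.2 := by
    refine continuous_eval_of_continuous_coeff (P := fun x => derivative (P x))
      (fun x => lt_of_le_of_lt degree_derivative_le (hPd x)) fun i => ?_
    simp_rw [coeff_derivative]
    exact (hPc (i + 1)).mul continuous_const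
  have heq : {x : (Fin n → ℂ) × (Fin n → ℂ) | ¬ GenericCondition A x.1 x.2} =
      {x | ∃ z, (x, z) ∈ {y : ((Fin n → ℂ) × (Fin n → ℂ)) × ℂ |
        (wronskian m (P y.1)).eval y.2 = 0 ∧ ‖(P y.1).eval y.2‖ = ‖m.eval y.2‖}} := by
    ext x
    simp [genericCondition_iff, hP, hm]
  rw [heq]
  refine isClosed_exists_of_locally_bounded (IsClosed.inter ?_ ?_) fun x => ?_
  · simp only [wronskian, eval_sub, eval_mul]
    exact isClosed_eq (((m.continuous.comp continuous_snd).mul hdev).sub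
      (((derivative m).continuous.comp continuous_snd).mul hev)) continuous_const
  · exact isClosed_eq hev.norm (m.continuous.comp continuous_snd).norm
  -- The extra 1 is slack: c still bounds the coefficients of p at all nearby (u, v), so one radius
  -- serves a whole neighbourhood.
  · set c : ℝ := 1 + ∑ i ∈ Finset.range m.natDegree, ‖(P x).coeff i‖
    have hc : 0 ≤ c := by positivity
    refine ⟨1 + ∑ i ∈ Finset.range m.natDegree, (‖m.coeff i‖ + c), ?_⟩
    have hcont : Continuous fun y => ∑ i ∈ Finset.range m.natDegree, ‖(P y).coeff i‖ :=
      continuous_finsetSum _ fun i _ => (hPc i).norm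
    filter_upwards [hcont.continuousAt.eventually_lt continuousAt_const
      (show _ < c from lt_one_add _)] with y hy z hz
    refine norm_le_of_norm_eval_le (minpoly_monic A) hc ?_
    rw [← hm, ← hz.2, eval_eq_sum_range_of_degree_lt (hPd y), Finset.mul_sum]
    refine (norm_sum_le _ _).trans (Finset.sum_le_sum fun i hi => ?_)
    rw [norm_mul, norm_pow]
    refine mul_le_mul_of_nonneg_right (le_trans ?_ hy.le) (by positivity)
    exact Finset.single_le_sum (f := fun i => ‖(P y).coeff i‖) (fun _ _ => norm_nonneg _) hi

theorem interior_setOf_eq_zero {E F : Type*} [AddCommGroup E] [TopologicalSpace E]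
    [ContinuousAdd E] [Module ℂ E] [ContinuousSMul ℂ E] [AddCommGroup F] [Module ℂ F]
    {f : E →ₗ[ℂ] F} (hf : f ≠ 0) : interior {x | f x = 0} = ∅ := by
  by_contra h
  exact hf (LinearMap.ker_eq_top.1
    (Submodule.eq_top_of_nonempty_interior' (LinearMap.ker f) (Set.nonempty_iff_ne_empty.2 h)))

theorem isClosed_interior_biUnion {X ι : Type*} [TopologicalSpace X] (s : Finset ι)
    {f : ι → Set X} (h : ∀ i ∈ s, IsClosed (f i) ∧ interior (f i) = ∅) :
    IsClosed (⋃ i ∈ s, f i) ∧ interior (⋃ i ∈ s, f i) = ∅ := by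
  classical
  induction s using Finset.induction_on with
  | empty => simp
  | insert a s _ ih =>
    obtain ⟨h1, h2⟩ := h a (Finset.mem_insert_self a s)
    obtain ⟨h3, h4⟩ := ih fun i hi => h i (Finset.mem_insert_of_mem hi)
    rw [Finset.set_biUnion_insert]
    exact ⟨h1.union h3, by rw [interior_union_isClosed_of_interior_empty h1 h4, h2]⟩

theorem isClosed_not_hasFullMinpoly (A : Matrix (Fin n) (Fin n) ℂ) :
    IsClosed {u | ¬ HasFullMinpoly A u} ∧ interior {u | ¬ HasFullMinpoly A u} = ∅ := by
  have h : {u | ¬ HasFullMinpoly A u} = ⋃ z ∈ (minpoly ℂ A).roots.toFinset,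
      {u | (cofactorAt A z).mulVecLin u = 0} := by
    ext u
    simp [hasFullMinpoly_iff, (minpoly_monic A).ne_zero]
  rw [h]
  refine isClosed_interior_biUnion _ fun z hz => ⟨?_, interior_setOf_eq_zero ?_⟩
  · exact isClosed_eq (Continuous.matrix_mulVec continuous_const continuous_id) continuous_const
  · intro h0
    rw [Multiset.mem_toFinset, mem_roots (minpoly_monic A).ne_zero] at hz
    refine cofactorAt_ne_zero A hz ?_
    rw [← Matrix.toLin'_apply'] at h0
    exact (LinearEquiv.map_eq_zero_iff _).1 h0

/-- The scalar is real so that the conjugation in v^* leaves it unchanged. -/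
theorem pPoly_smul (A : Matrix (Fin n) (Fin n) ℂ) (u v : Fin n → ℂ) (t : ℝ) :
    pPoly A u ((t : ℂ) • v) = C (t : ℂ) * pPoly A u v := by
  ext i
  rw [coeff_C_mul, pPoly_coeff, pPoly_coeff, Finset.mul_sum]
  refine Finset.sum_congr rfl fun k _ => ?_
  split_ifs
  · rw [star_smul, smul_dotProduct, smul_eq_mul]
    simp
    ring
  · simp

theorem dense_not_accidentallyFrozen {A : Matrix (Fin n) (Fin n) ℂ} {u : Fin n → ℂ}
    (hu : HasFullMinpoly A u) : Dense {v | ∀ z, ¬ AccidentallyFrozen A u v z} := by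
  have h : {v | ∀ z, ¬ AccidentallyFrozen A u v z} = (⋃ z ∈ (minpoly ℂ A).roots.toFinset,
      {v | dotProductBilin ℂ ℂ (star (Matrix.mulVec (cofactorAt A z) u)) v = 0})ᶜ := by
    ext v
    simp only [Set.mem_ofPred_eq, Set.compl_iUnion, Set.mem_iInter, Multiset.mem_toFinset,
      mem_roots (minpoly_monic A).ne_zero, AccidentallyFrozen, not_and]
    refine forall_congr' fun z => forall_congr' fun hz => ?_
    rw [IsRoot, eval_pPoly_of_isRoot A u v hz, Set.mem_compl_iff, Set.mem_ofPred_eq,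
      dotProductBilin_apply_apply]
    -- The condition is antilinear in v; conjugating makes its solution set the kernel of a linear
    -- form.
    have e : star (Matrix.mulVec (cofactorAt A z) u) ⬝ᵥ v =
        star (star v ⬝ᵥ Matrix.mulVec (cofactorAt A z) u) := by
      simp [dotProduct, mul_comm]
    rw [e, star_eq_zero]
  rw [h, ← interior_eq_empty_iff_dense_compl]
  refine (isClosed_interior_biUnion _ fun z hz => ⟨?_, interior_setOf_eq_zero fun h0 => ?_⟩).2
  · simp only [dotProductBilin_apply_apply]
    exact isClosed_eq (Continuous.dotProduct continuous_const continuous_id) continuous_const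
  · rw [Multiset.mem_toFinset, mem_roots (minpoly_monic A).ne_zero] at hz
    refine (hasFullMinpoly_iff A u).1 hu z hz (star_eq_zero.1 ?_)
    refine dotProduct_eq_zero_iff.1 fun w => ?_
    exact LinearMap.congr_fun h0 w

theorem dense_genericCondition {A : Matrix (Fin n) (Fin n) ℂ} {u : Fin n → ℂ}
    (hu : HasFullMinpoly A u) : Dense {v | GenericCondition A u v} := by
  -- Here m = 1 and p = 0, the one case where the Wronskian vanishes identically without accidental
  -- freezing.
  by_cases hl : (minpoly ℂ A).natDegree = 0
  · refine dense_univ.mono fun v _ => (genericCondition_iff A u v).2 fun z _ => ?_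
    rw [eval_eq_sum_range_of_degree_lt (pPoly_degree_lt A u v), hl,
      (minpoly_monic A).natDegree_eq_zero.1 hl]
    simp
  rw [dense_iff_inter_open]
  intro W hW hne
  obtain ⟨v, hvW, hv⟩ := (dense_not_accidentallyFrozen hu).inter_open_nonempty W hW hne
  have hcont : Continuous fun t : ℝ => (t : ℂ) • v := by fun_prop
  set w := wronskian (minpoly ℂ A) (pPoly A u v) with hw
  have hw0 : w ≠ 0 := wronskian_ne_zero hv hl
  set T : Finset ℝ := w.roots.toFinset.image
    fun z => ‖(minpoly ℂ A).eval z‖ / ‖(pPoly A u v).eval z‖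
  -- Scaling v by t scales p and the Wronskian by t, so the Wronskian keeps its zeros while |p|
  -- there becomes t|p|. Only the finitely many ratios in `T` are forbidden, and t = 1 shows that
  -- the open set is nonempty.
  obtain ⟨t, ⟨ht1, ht0⟩, htT⟩ := ((T.countable_toSet.dense_compl ℝ).inter_open_nonempty
    ((fun t : ℝ => (t : ℂ) • v) ⁻¹' W ∩ Set.Ioi 0) ((hW.preimage hcont).inter isOpen_Ioi)
    ⟨1, by simpa using hvW⟩)
  refine ⟨(t : ℂ) • v, ht1, (genericCondition_iff _ _ _).2 fun z hz heq => htT ?_⟩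
  have ht0' : (t : ℂ) ≠ 0 := Complex.ofReal_ne_zero.2 (ne_of_gt ht0)
  have hz' : w.eval z = 0 := by
    refine (mul_eq_zero.1 ?_).resolve_left ht0'
    rw [← hz, pPoly_smul, hw]
    simp [wronskian]
    ring
  rw [pPoly_smul, eval_mul, eval_C, norm_mul, Complex.norm_real, Real.norm_of_nonneg ht0.le] at heq
  have hp : (pPoly A u v).eval z ≠ 0 := by
    intro h0
    rw [h0, norm_zero, mul_zero, eq_comm, norm_eq_zero] at heq
    exact hv z ⟨heq, h0⟩
  refine Finset.mem_coe.2 (Finset.mem_image.2 ⟨z, ?_, ?_⟩)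
  · rw [Multiset.mem_toFinset, mem_roots hw0]
    exact hz'
  · rw [← heq, mul_div_cancel_right₀ _ (norm_ne_zero_iff.2 hp)]

theorem isClosed_interior_not_genericCondition (A : Matrix (Fin n) (Fin n) ℂ) {u : Fin n → ℂ}
    (hu : HasFullMinpoly A u) :
    IsClosed {v | ¬ GenericCondition A u v} ∧ interior {v | ¬ GenericCondition A u v} = ∅ := by
  refine ⟨(isClosed_not_genericCondition A).preimage (Continuous.prodMk_right u), ?_⟩
  rw [interior_eq_empty_iff_dense_compl]
  simpa [Set.compl_def] using dense_genericCondition hu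

/-- Move u first, to a vector with full minimal polynomial, then v. -/
theorem interior_not_genericCondition (A : Matrix (Fin n) (Fin n) ℂ) :
    interior {x : (Fin n → ℂ) × (Fin n → ℂ) | ¬ GenericCondition A x.1 x.2} = ∅ := by
  rw [interior_eq_empty_iff_dense_compl, dense_iff_inter_open]
  rintro W hW ⟨⟨u₀, v₀⟩, h₀⟩
  have hd := interior_eq_empty_iff_dense_compl.1 (isClosed_not_hasFullMinpoly A).2
  obtain ⟨u, hu, hfull⟩ := hd.inter_open_nonempty _ (hW.preimage (Continuous.prodMk_left v₀))
    ⟨u₀, h₀⟩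
  have hfull : HasFullMinpoly A u := by simpa using hfull
  obtain ⟨v, hv, hgen⟩ := (dense_genericCondition hfull).inter_open_nonempty _
    (hW.preimage (Continuous.prodMk_right u)) ⟨v₀, hu⟩
  exact ⟨(u, v), hv, fun h => h hgen⟩

/-! ### The covering m/p and its holomorphic branches -/

/-- The nonzero values `τ` for which `m - τ p` has only simple zeros. -/
def regularParameters (m p : ℂ[X]) : Set ℂ :=
  {τ | τ ≠ 0 ∧ ∀ z, m.eval z = τ * p.eval z → (wronskian m p).eval z ≠ 0}

section

variable {m p : ℂ[X]}

theorem eval_ne_zero_of_isCoprime (hcop : IsCoprime m p) {τ z : ℂ}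
    (h : m.eval z = τ * p.eval z) : p.eval z ≠ 0 := by
  intro h0
  rw [h0, mul_zero] at h
  rcases (isCoprime_iff_aeval_ne_zero_of_isAlgClosed ℂ ℂ m p).1 hcop z with h1 | h1
  · exact h1 (by simpa using h)
  · exact h1 (by simpa using h0)

/-- Since deg p < deg m, the solutions of m = τp stay bounded while τ does, so no limit escapes to
infinity. -/
theorem isClosedMap_div (hm : m.Monic) (hd : p.degree < m.natDegree) (hcop : IsCoprime m p) :
    IsClosedMap fun z => m.eval z / p.eval z := by
  by_cases hp : p = 0
  · simp only [hp, eval_zero, div_zero]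
    exact isClosedMap_const
  intro K hK
  -- Division by zero sends the zeros of p to 0. They contribute a finite set, treated apart; this
  -- is also why `regularParameters` omits 0.
  have heq : (fun z => m.eval z / p.eval z) '' K =
      {τ | ∃ z, (τ, z) ∈ {y : ℂ × ℂ | y.2 ∈ K ∧ m.eval y.2 = y.1 * p.eval y.2}} ∪
        (fun z => m.eval z / p.eval z) '' (K ∩ {z | p.IsRoot z}) := by
    ext τ
    constructor
    · rintro ⟨z, hz, rfl⟩
      by_cases h : p.eval z = 0
      · exact Or.inr ⟨z, ⟨hz, h⟩, rfl⟩
      · exact Or.inl ⟨z, hz, (div_mul_cancel₀ _ h).symm⟩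
    · rintro (⟨z, hz, h⟩ | ⟨z, ⟨hz, -⟩, h⟩)
      · exact ⟨z, hz, (div_eq_iff (eval_ne_zero_of_isCoprime hcop h)).2 h⟩
      · exact ⟨z, hz, h⟩
  rw [heq]
  refine IsClosed.union (isClosed_exists_of_locally_bounded (IsClosed.inter
    (hK.preimage continuous_snd) (isClosed_eq (m.continuous.comp continuous_snd)
      (continuous_fst.mul (p.continuous.comp continuous_snd)))) fun τ => ?_) ?_
  · set c : ℝ := (‖τ‖ + 1) * ∑ i ∈ Finset.range m.natDegree, ‖p.coeff i‖
    refine ⟨1 + ∑ i ∈ Finset.range m.natDegree, (‖m.coeff i‖ + c), ?_⟩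
    filter_upwards [continuous_norm.continuousAt.eventually_lt continuousAt_const
      (lt_add_one ‖τ‖)] with σ hσ z hz
    refine norm_le_of_norm_eval_le hm (c := c) (by positivity) ?_
    rw [hz.2, norm_mul, mul_assoc]
    refine mul_le_mul hσ.le ?_ (norm_nonneg _) (by positivity)
    rw [eval_eq_sum_range_of_degree_lt hd, Finset.mul_sum]
    refine (norm_sum_le _ _).trans (Finset.sum_le_sum fun i hi => ?_)
    rw [norm_mul, norm_pow]
    refine mul_le_mul_of_nonneg_right ?_ (by positivity)
    exact Finset.single_le_sum (f := fun i => ‖p.coeff i‖) (fun _ _ => norm_nonneg _) hi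
  · refine (((finite_setOfPred_isRoot hp).subset Set.inter_subset_right).image _).isClosed

theorem hasStrictDerivAt_div {z : ℂ} (hp : p.eval z ≠ 0) :
    HasStrictDerivAt (fun z => m.eval z / p.eval z)
      (-(wronskian m p).eval z / (p.eval z) ^ 2) z := by
  refine ((m.hasStrictDerivAt z).div (p.hasStrictDerivAt z) hp).congr_deriv ?_
  simp only [wronskian, eval_sub, eval_mul]
  ring

theorem eval_eq_of_div_eq {τ z : ℂ} (hτ : τ ≠ 0) (h : m.eval z / p.eval z = τ) :
    m.eval z = τ * p.eval z := by
  have hp : p.eval z ≠ 0 := by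
    rintro h0
    rw [h0, div_zero] at h
    exact hτ h.symm
  exact (div_eq_iff hp).1 h

theorem isCoveringMapOn_div (hm : m.Monic) (hd : p.degree < m.natDegree)
    (hcop : IsCoprime m p) :
    IsCoveringMapOn (fun z => m.eval z / p.eval z) (regularParameters m p) := by
  refine (isClosedMap_div hm hd hcop).isCoveringMapOn_of_isLocalHomeomorphOn
    (fun τ hτ => ?_) fun z hz => ?_
  · have hne : m - C τ * p ≠ 0 := by
      refine (hm.sub_of_left ?_).ne_zero
      rw [degree_eq_natDegree hm.ne_zero, ← smul_eq_C_mul]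
      exact lt_of_le_of_lt (degree_smul_le _ _) hd
    refine (finite_setOfPred_isRoot hne).subset fun z hz => ?_
    simpa [IsRoot, sub_eq_zero] using eval_eq_of_div_eq hτ.1 hz
  · have he := eval_eq_of_div_eq hz.1 rfl
    have hp := eval_ne_zero_of_isCoprime hcop he
    have hw := hz.2 z he
    have hs := (hasStrictDerivAt_div (m := m) hp).hasStrictFDerivAt_equiv
      (div_ne_zero (neg_ne_zero.2 hw) (pow_ne_zero 2 hp))
    exact ⟨_, hs.mem_toOpenPartialHomeomorph_source, by simp⟩

theorem isOpen_regularParameters (hm : m.Monic) (hd : p.degree < m.natDegree)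
    (hcop : IsCoprime m p) : IsOpen (regularParameters m p) := by
  by_cases hw : wronskian m p = 0
  · have hl : m.natDegree = 0 := derivative_eq_zero.1 (hcop.wronskian_eq_zero_iff.1 hw).1
    have hp : p = 0 := by
      rw [hl] at hd
      exact degree_eq_bot.1 (Nat.WithBot.lt_zero_iff.1 hd)
    have h1 := hm.natDegree_eq_zero.1 hl
    have : regularParameters m p = {0}ᶜ := by
      ext τ
      simp [regularParameters, hp, h1]
    rw [this]
    exact isOpen_compl_singleton
  · have : regularParameters m p =
        ({0} ∪ (fun z => m.eval z / p.eval z) '' {z | (wronskian m p).IsRoot z})ᶜ := by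
      ext τ
      simp only [regularParameters, Set.mem_ofPred_eq, Set.mem_compl_iff, Set.mem_union,
        Set.mem_singleton_iff, not_or, Set.mem_image, not_exists, not_and]
      refine and_congr_right fun hτ => forall_congr' fun z => ?_
      constructor
      · exact fun h hz h' => h (eval_eq_of_div_eq hτ h') hz
      · exact fun h h' hz => h hz ((div_eq_iff (eval_ne_zero_of_isCoprime hcop h')).2 h')
    rw [this]
    exact ((Set.finite_singleton _).union
      ((finite_setOfPred_isRoot hw).image _)).isClosed.isOpen_compl

/-- Along a map with values in the regular parameters, defined on a convex open set, each zero
of `m - τ p` can be continued to a holomorphic function. -/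
theorem exists_branch (hm : m.Monic) (hd : p.degree < m.natDegree) (hcop : IsCoprime m p)
    {V : Set ℂ} (hV : IsOpen V) (hconv : Convex ℝ V) {h : ℂ → ℂ} (hh : DifferentiableOn ℂ h V)
    (hreg : ∀ w ∈ V, h w ∈ regularParameters m p) {a z : ℂ} (ha : a ∈ V)
    (hz : m.eval z = h a * p.eval z) :
    ∃ μ : ℂ → ℂ, μ a = z ∧ DifferentiableOn ℂ μ V ∧
      ∀ w ∈ V, m.eval (μ w) = h w * p.eval (μ w) := by
  have : ContractibleSpace V := hconv.contractibleSpace ⟨a, ha⟩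
  have : LocallyPathConnectedSpace V := hV.locallyPathConnectedSpace
  obtain ⟨F, ⟨hF0, hF⟩, -⟩ := (isCoveringMapOn_div hm hd hcop).existsUnique_continuousMap_lifts
    (A := V) ⟨V.domRestrict h, hh.continuousOn.domRestrict⟩ (a₀ := ⟨a, ha⟩) (e₀ := z)
    ((div_eq_iff (eval_ne_zero_of_isCoprime hcop hz)).2 hz) (fun w => hreg w w.2)
  classical
  set μ : ℂ → ℂ := fun w => if hw : w ∈ V then F ⟨w, hw⟩ else 0 with hμ
  have hμF : V.domRestrict μ = F := by
    ext w
    simp [hμ]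
  have hcont : ContinuousOn μ V := by
    rw [continuousOn_iff_continuous_domRestrict, hμF]
    exact F.continuous
  have hdiv : ∀ w ∈ V, m.eval (μ w) / p.eval (μ w) = h w := by
    intro w hw
    have h1 : F ⟨w, hw⟩ = μ w := (congrFun hμF ⟨w, hw⟩).symm
    rw [← h1]
    exact congrFun hF ⟨w, hw⟩
  have hsol : ∀ w ∈ V, m.eval (μ w) = h w * p.eval (μ w) :=
    fun w hw => eval_eq_of_div_eq (hreg w hw).1 (hdiv w hw)
  refine ⟨μ, by simpa [hμ, ha] using hF0, fun w hw => ?_, hsol⟩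
  have hp := eval_ne_zero_of_isCoprime hcop (hsol w hw)
  have hw' := (hreg w hw).2 _ (hsol w hw)
  have hs := hasStrictDerivAt_div (m := m) hp
  have hne := div_ne_zero (neg_ne_zero.2 hw') (pow_ne_zero 2 hp)
  have hgood := hs.eventually_left_inverse hne
  -- The lift is only continuous a priori; locally it is h followed by a differentiable local
  -- inverse of m/p.
  have hev : μ =ᶠ[nhds w] fun y => hs.localInverse _ _ _ hne (h y) := by
    filter_upwards [(hcont.continuousAt (hV.mem_nhds hw)).eventually hgood,
      hV.mem_nhds hw] with y hy hyV
    rw [← hdiv y hyV]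
    exact hy.symm
  have hinv := (hs.to_localInverse hne).hasDerivAt.differentiableAt
  rw [hdiv w hw] at hinv
  exact ((hinv.comp w (hh.differentiableAt (hV.mem_nhds hw))).congr_of_eventuallyEq
    hev).differentiableWithinAt

theorem eqOn_of_branches (hm : m.Monic) (hd : p.degree < m.natDegree) (hcop : IsCoprime m p)
    {V : Set ℂ} (hV : IsOpen V) (hconv : Convex ℝ V) {h : ℂ → ℂ} (hh : ContinuousOn h V)
    (hreg : ∀ w ∈ V, h w ∈ regularParameters m p) {μ ν : ℂ → ℂ} (hμc : ContinuousOn μ V)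
    (hνc : ContinuousOn ν V) (hμ : ∀ w ∈ V, m.eval (μ w) = h w * p.eval (μ w))
    (hν : ∀ w ∈ V, m.eval (ν w) = h w * p.eval (ν w)) {a : ℂ} (ha : a ∈ V) (hab : μ a = ν a) :
    Set.EqOn μ ν V := by
  have : ContractibleSpace V := hconv.contractibleSpace ⟨a, ha⟩
  have : LocallyPathConnectedSpace V := hV.locallyPathConnectedSpace
  have hdiv : ∀ {ξ : ℂ → ℂ}, (∀ w ∈ V, m.eval (ξ w) = h w * p.eval (ξ w)) →
      ∀ w ∈ V, m.eval (ξ w) / p.eval (ξ w) = h w := fun hξ w hw =>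
    (div_eq_iff (eval_ne_zero_of_isCoprime hcop (hξ w hw))).2 (hξ w hw)
  have huniq := (isCoveringMapOn_div hm hd hcop).existsUnique_continuousMap_lifts
    (A := V) ⟨V.domRestrict h, hh.domRestrict⟩ (a₀ := ⟨a, ha⟩) (e₀ := μ a) (hdiv hμ a ha)
    (fun w => hreg w w.2)
  have key := huniq.unique (y₁ := ⟨V.domRestrict μ, hμc.domRestrict⟩)
    (y₂ := ⟨V.domRestrict ν, hνc.domRestrict⟩) ⟨rfl, funext fun w => hdiv hμ w w.2⟩
    ⟨hab.symm, funext fun w => hdiv hν w w.2⟩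
  intro w hw
  exact DFunLike.congr_fun key ⟨w, hw⟩

/-- A double zero would satisfy m = τp and m' = τp', which forces the Wronskian to vanish. -/
theorem nodup_roots_of_mem_regularParameters {τ : ℂ} (hτ : τ ∈ regularParameters m p) :
    (m - C τ * p).roots.Nodup := by
  refine nodup_roots ((isCoprime_iff_aeval_ne_zero_of_isAlgClosed ℂ ℂ _ _).2 fun z => ?_)
  by_contra! hz
  simp only [coe_aeval_eq_eval, eval_sub, eval_mul, eval_C, derivative_sub, derivative_mul,
    derivative_C, zero_mul, zero_add, sub_eq_zero] at hz
  refine hτ.2 z hz.1 ?_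
  simp only [wronskian, eval_sub, eval_mul, hz.1, hz.2]
  ring

end

/-! ### The arc, its angular coordinate and the ordering of branches -/

/-- The sign moves the cut of the logarithm to the positive ray, which meets the unit circle only at
the excluded point 1. -/
theorem neg_mem_slitPlane {τ : ℂ} (h1 : ‖τ‖ = 1) (hne : τ ≠ 1) : -τ ∈ Complex.slitPlane := by
  by_contra h
  rw [Complex.mem_slitPlane_iff, not_or, not_lt, not_not, Complex.neg_re, Complex.neg_im,
    neg_eq_zero, neg_nonpos] at h
  refine hne (Complex.ext ?_ h.2)
  have := (Complex.abs_re_eq_norm (z := τ)).2 h.2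
  rw [h1, abs_of_nonneg h.1] at this
  exact this

theorem mem_arc_iff {τ : ℂ} : τ ∈ arc ↔ ‖τ‖ = 1 ∧ τ ≠ 1 := by
  constructor
  · rintro ⟨θ, ⟨h0, h1⟩, rfl⟩
    refine ⟨Complex.norm_exp_ofReal_mul_I θ, fun h => ?_⟩
    obtain ⟨k, hk⟩ := Complex.exp_eq_one_iff.1 h
    have hk' : θ = k * (2 * Real.pi) := by
      have h2 : (θ : ℂ) = k * (2 * Real.pi) := by
        refine mul_right_cancel₀ Complex.I_ne_zero ?_
        rw [hk]
        ring
      exact_mod_cast h2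
    have hpi := Real.two_pi_pos
    rw [hk'] at h0 h1
    have hk0 : (0 : ℝ) < k := pos_of_mul_pos_left h0 hpi.le
    have hk1 : (k : ℝ) < 1 := by
      by_contra! hge
      nlinarith
    norm_cast at hk0 hk1
    omega
  · rintro ⟨h1, hne⟩
    have hs := neg_mem_slitPlane h1 hne
    have hpi := (Complex.mem_slitPlane_iff_arg.1 hs).1
    refine ⟨Complex.arg (-τ) + Real.pi, ⟨?_, ?_⟩, ?_⟩
    · linarith [Complex.neg_pi_lt_arg (-τ)]
    · have := lt_of_le_of_ne (Complex.arg_le_pi (-τ)) hpi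
      linarith
    · have h := Complex.norm_mul_exp_arg_mul_I (-τ)
      rw [norm_neg, h1, Complex.ofReal_one, one_mul] at h
      rw [Complex.ofReal_add, add_mul, Complex.exp_add, h, Complex.exp_pi_mul_I]
      ring

theorem isPreconnected_arc : IsPreconnected arc := by
  have : arc = (fun θ : ℝ => Complex.exp ((θ : ℂ) * Complex.I)) '' Set.Ioo 0 (2 * Real.pi) := by
    ext τ
    simp [arc, eq_comm]
  rw [this]
  exact isPreconnected_Ioo.image _ (by fun_prop)

theorem neg_one_mem_arc : (-1 : ℂ) ∈ arc := mem_arc_iff.2 ⟨by simp, by norm_num⟩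

/-- Continuous functions on a preconnected set listing the same multisets agree up to a
permutation, if one of the lists never has repetitions. -/
theorem exists_perm_of_map_eq {X Y : Type*} [TopologicalSpace X] [TopologicalSpace Y] [T2Space Y]
    {S : Set X} (hS : IsPreconnected S) (hne : S.Nonempty) {l : ℕ} {f g : Fin l → X → Y}
    (hf : ∀ j, ContinuousOn (f j) S) (hg : ∀ j, ContinuousOn (g j) S)
    (hinj : ∀ x ∈ S, Function.Injective fun j => f j x)
    (h : ∀ x ∈ S, Multiset.map (fun j => g j x) (Finset.univ : Finset (Fin l)).val =
      Multiset.map (fun j => f j x) (Finset.univ : Finset (Fin l)).val) :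
    ∃ s : Equiv.Perm (Fin l), ∀ j, ∀ x ∈ S, g j x = f (s j) x := by
  have hpre : PreconnectedSpace S := isPreconnected_iff_preconnectedSpace.1 hS
  obtain ⟨x₀, hx₀⟩ := hne
  have hex : ∀ j, ∀ x : S, ∃ i, f i x = g j x := by
    intro j x
    have hmem : g j x ∈ Multiset.map (fun j => g j x) (Finset.univ : Finset (Fin l)).val :=
      Multiset.mem_map_of_mem _ (Finset.mem_univ j)
    rw [h x x.2, Multiset.mem_map] at hmem
    obtain ⟨i, -, hi⟩ := hmem
    exact ⟨i, hi⟩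
  choose k hk using hex
  have hcont : ∀ j, Continuous (k j) := by
    intro j
    refine continuous_iff_isClosed.2 fun T _ => ?_
    -- By injectivity the index matching g j is determined by closed coincidence conditions, finite
    -- in number; it is therefore continuous, hence constant.
    have : k j ⁻¹' T = ⋃ i ∈ T, {x : S | f i x = g j x} := by
      ext x
      simp only [Set.mem_preimage, Set.mem_iUnion, Set.mem_ofPred_eq, exists_prop]
      constructor
      · exact fun hT => ⟨_, hT, hk j x⟩
      · rintro ⟨i, hT, hi⟩
        have : i = k j x := hinj x x.2 (hi.trans (hk j x).symm)
        exact this ▸ hT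
    rw [this]
    exact (Set.toFinite T).isClosed_biUnion fun i _ =>
      isClosed_eq (hf i).domRestrict (hg j).domRestrict
  have hs : ∀ j, ∀ x (hx : x ∈ S), g j x = f (k j ⟨x₀, hx₀⟩) x := by
    intro j x hx
    rw [← hk j ⟨x, hx⟩, PreconnectedSpace.constant hpre (hcont j) (x := ⟨x₀, hx₀⟩) (y := ⟨x, hx⟩)]
  have hsinj : Function.Injective fun j => k j ⟨x₀, hx₀⟩ := by
    intro i j hij
    have hnd : (Multiset.map (fun j => g j x₀) (Finset.univ : Finset (Fin l)).val).Nodup := by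
      rw [h x₀ hx₀]
      exact (Finset.univ.nodup).map (hinj x₀ hx₀)
    refine Multiset.inj_on_of_nodup_map hnd i (Finset.mem_univ i) j (Finset.mem_univ j) ?_
    rw [hs i x₀ hx₀, hs j x₀ hx₀]
    exact congrArg (fun t => f t x₀) hij
  exact ⟨Equiv.ofBijective _ (Finite.injective_iff_bijective.1 hsinj), hs⟩

/-- A complex angular parameter for `τ`, with `exp (i w) = -τ`. -/
noncomputable def angle (τ : ℂ) : ℂ := -Complex.I * Complex.log (-τ)

theorem neg_exp_I_mul_angle {τ : ℂ} (hτ : τ ≠ 0) : -Complex.exp (Complex.I * angle τ) = τ := by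
  have : Complex.I * angle τ = Complex.log (-τ) := by
    rw [angle, ← mul_assoc, mul_neg, Complex.I_mul_I, neg_neg, one_mul]
  rw [this, Complex.exp_log (neg_ne_zero.2 hτ), neg_neg]

theorem angle_mem_of_mem_arc {τ : ℂ} (hτ : τ ∈ arc) :
    angle τ ∈ Complex.ofReal '' Set.Icc (-Real.pi) Real.pi := by
  refine ⟨Complex.arg (-τ), ⟨(Complex.neg_pi_lt_arg _).le, Complex.arg_le_pi _⟩, ?_⟩
  rw [angle, Complex.log, norm_neg, (mem_arc_iff.1 hτ).1, Real.log_one, Complex.ofReal_zero,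
    zero_add, mul_comm (Complex.arg (-τ) : ℂ), ← mul_assoc, neg_mul, Complex.I_mul_I, neg_neg,
    one_mul]

theorem differentiableOn_angle : DifferentiableOn ℂ angle {τ | -τ ∈ Complex.slitPlane} := by
  intro τ hτ
  exact ((differentiableAt_id.neg.clog hτ).const_mul _).differentiableWithinAt

theorem mem_regularParameters {A : Matrix (Fin n) (Fin n) ℂ} {u v : Fin n → ℂ}
    (hgen : GenericCondition A u v) {τ : ℂ} (hτ : ‖τ‖ = 1) :
    τ ∈ regularParameters (minpoly ℂ A) (pPoly A u v) := by
  refine ⟨norm_ne_zero_iff.1 (by rw [hτ]; exact one_ne_zero), fun z hz hw => ?_⟩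
  refine (genericCondition_iff A u v).1 hgen z hw ?_
  rw [hz, norm_mul, hτ, one_mul]

/-- Under the generic condition, the circle of parameters has a convex neighbourhood of angular
parameters over which the zeros of `m_A - τ p` stay simple. -/
theorem exists_convex_nhds {A : Matrix (Fin n) (Fin n) ℂ} {u v : Fin n → ℂ}
    (hgen : GenericCondition A u v) :
    ∃ V : Set ℂ, IsOpen V ∧ Convex ℝ V ∧ Complex.ofReal '' Set.Icc (-Real.pi) Real.pi ⊆ V ∧
      ∀ w ∈ V, -Complex.exp (Complex.I * w) ∈ regularParameters (minpoly ℂ A) (pPoly A u v) := by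
  have hopen := (isOpen_regularParameters (minpoly_monic A) (pPoly_degree_lt A u v)
    (isCoprime_minpoly_pPoly hgen.1)).preimage
    (show Continuous fun w : ℂ => -Complex.exp (Complex.I * w) by fun_prop)
  -- The generic condition also covers τ = 1, so the closed interval, which is compact, is available
  -- and has a thickening of uniform width.
  obtain ⟨δ, hδ, hsub⟩ := (isCompact_Icc.image Complex.continuous_ofReal).exists_thickening_subset_open
    (s := Complex.ofReal '' Set.Icc (-Real.pi) Real.pi) hopen (by
      rintro _ ⟨θ, -, rfl⟩
      refine mem_regularParameters hgen ?_
      rw [norm_neg, mul_comm, Complex.norm_exp_ofReal_mul_I])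
  refine ⟨_, Metric.isOpen_thickening, ?_, Metric.self_subset_thickening hδ _,
    fun w hw => hsub hw⟩
  exact ((convex_Icc _ _).linear_image Complex.ofRealCLM.toLinearMap).thickening δ

theorem exists_injective_roots {P : ℂ[X]} (h : P.roots.Nodup) {l : ℕ} (hl : P.natDegree = l) :
    ∃ z : Fin l → ℂ, Function.Injective z ∧ ∀ j, z j ∈ P.roots := by
  have hc : P.roots.toFinset.card = l := by
    rw [Multiset.toFinset_card_of_nodup h, ← hl]
    exact splits_iff_card_roots.1 (IsAlgClosed.splits P)
  let e := (P.roots.toFinset.equivFinOfCardEq hc).symm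
  exact ⟨fun j => e j, Subtype.val_injective.comp e.injective,
    fun j => Multiset.mem_toFinset.1 (e j).2⟩

theorem roots_eq_map {P : ℂ[X]} (hP : P ≠ 0) {l : ℕ} (hl : P.natDegree = l) {z : Fin l → ℂ}
    (hz : Function.Injective z) (hr : ∀ j, P.IsRoot (z j)) :
    P.roots = Multiset.map z (Finset.univ : Finset (Fin l)).val := by
  symm
  refine Multiset.eq_of_le_of_card_le ?_ ?_
  · rw [Multiset.le_iff_subset (Finset.univ.nodup.map hz)]
    intro w hw
    obtain ⟨j, -, rfl⟩ := Multiset.mem_map.1 hw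
    exact (mem_roots hP).2 (hr j)
  · rw [Multiset.card_map, Finset.card_val, Finset.card_univ, Fintype.card_fin, ← hl]
    exact card_roots' P

/-! ### The generic condition and global angular eigenvalues -/

theorem spectrum_pert_diff {A : Matrix (Fin n) (Fin n) ℂ} {u v : Fin n → ℂ}
    (hfr : ∀ z, ¬ AccidentallyFrozen A u v z) {τ : ℂ} (hτ : τ ≠ 0) :
    spectrum ℂ (pert A u v τ) \ {z | (minpoly ℂ A - C τ * pPoly A u v).IsRoot z} =
      {z | StructurallyFrozen A z} := by
  ext z
  rw [Set.mem_sdiff, Matrix.mem_spectrum_iff_isRoot_charpoly, charpoly_pert, root_mul,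
    Set.mem_ofPred_eq, Set.mem_ofPred_eq]
  constructor
  · exact fun h => h.1.resolve_right h.2
  · refine fun h => ⟨Or.inl h, fun h' => ?_⟩
    have hm := isRoot_minpoly_of_structurallyFrozen h
    rw [isRoot_minpoly_sub_iff, hm.eq_zero, eq_comm, mul_eq_zero] at h'
    exact hfr z ⟨hm, h'.resolve_left hτ⟩

theorem globalAngularEigenvalues_of_genericCondition {A : Matrix (Fin n) (Fin n) ℂ}
    {u v : Fin n → ℂ} (hgen : GenericCondition A u v) : GlobalAngularEigenvalues A u v := by
  have hfr := hgen.1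
  set m := minpoly ℂ A with hmdef
  set p := pPoly A u v with hpdef
  have hm : m.Monic := minpoly_monic A
  have hd : p.degree < m.natDegree := pPoly_degree_lt A u v
  have hcop : IsCoprime m p := isCoprime_minpoly_pPoly hfr
  obtain ⟨V, hV, hconv, hKV, hreg⟩ := exists_convex_nhds hgen
  have hh : Differentiable ℂ fun w : ℂ => -Complex.exp (Complex.I * w) := by fun_prop
  have h0V : (0 : ℂ) ∈ V := hKV ⟨0, ⟨by linarith [Real.pi_pos], Real.pi_pos.le⟩, rfl⟩
  -- The base point w = 0 corresponds to τ = -1, the midpoint of the arc.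
  obtain ⟨hP0, hPd⟩ := minpoly_sub_degree A u v (-Complex.exp (Complex.I * 0))
  obtain ⟨z, hzinj, hzroot⟩ := exists_injective_roots
    (nodup_roots_of_mem_regularParameters (hreg 0 h0V)) hPd
  have hbr : ∀ j, ∃ μ : ℂ → ℂ, μ 0 = z j ∧ DifferentiableOn ℂ μ V ∧
      ∀ w ∈ V, m.eval (μ w) = -Complex.exp (Complex.I * w) * p.eval (μ w) := fun j =>
    exists_branch hm hd hcop hV hconv hh.differentiableOn hreg h0V
      ((isRoot_minpoly_sub_iff A u v _ _).1 ((mem_roots hP0.ne_zero).1 (hzroot j)))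
  choose μ hμ0 hμd hμ using hbr
  have hμinj : ∀ w ∈ V, Function.Injective fun j => μ j w := by
    intro w hw i j hij
    have heq := eqOn_of_branches hm hd hcop hV hconv hh.continuous.continuousOn hreg
      (hμd i).continuousOn (hμd j).continuousOn (hμ i) (hμ j) hw hij
    exact hzinj (by rw [← hμ0, ← hμ0, heq h0V])
  set U : Set ℂ := {τ | -τ ∈ Complex.slitPlane} ∩ angle ⁻¹' V with hU
  have hUopen : IsOpen U := differentiableOn_angle.continuousOn.isOpen_inter_preimage
    (Complex.isOpen_slitPlane.preimage continuous_neg) hV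
  have harcU : arc ⊆ U := fun τ hτ =>
    ⟨neg_mem_slitPlane (mem_arc_iff.1 hτ).1 (mem_arc_iff.1 hτ).2, hKV (angle_mem_of_mem_arc hτ)⟩
  have harc0 : ∀ τ ∈ arc, τ ≠ 0 := fun τ hτ =>
    norm_ne_zero_iff.1 (by rw [(mem_arc_iff.1 hτ).1]; exact one_ne_zero)
  set lam : Fin m.natDegree → ℂ → ℂ := fun j τ => μ j (angle τ) with hlam
  have hlamd : ∀ j, DifferentiableOn ℂ (lam j) U := fun j =>
    (hμd j).comp (differentiableOn_angle.mono Set.inter_subset_left) fun τ hτ => hτ.2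
  have hlamroot : ∀ j, ∀ τ ∈ arc, m.eval (lam j τ) = τ * p.eval (lam j τ) := by
    intro j τ hτ
    have := hμ j _ (harcU hτ).2
    rwa [neg_exp_I_mul_angle (harc0 τ hτ)] at this
  have hlaminj : ∀ τ ∈ arc, Function.Injective fun j => lam j τ := fun τ hτ =>
    hμinj _ (harcU hτ).2
  have hroots : ∀ τ ∈ arc, (m - C τ * p).roots =
      Multiset.map (fun j => lam j τ) (Finset.univ : Finset (Fin m.natDegree)).val := by
    intro τ hτ
    obtain ⟨h0, h1⟩ := minpoly_sub_degree A u v τ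
    exact roots_eq_map h0.ne_zero h1 (hlaminj τ hτ)
      fun j => (isRoot_minpoly_sub_iff A u v τ _).2 (hlamroot j τ hτ)
  have hfam : IsEigenvalueFamily A u v lam :=
    ⟨fun j => (hlamd j).continuousOn.mono harcU, fun τ hτ => by
      rw [newEigenvalues_pert hfr (harc0 τ hτ)]
      exact hroots τ hτ⟩
  refine ⟨lam, hfam, fun lam' hlam' => ?_, fun τ hτ => ?_, hfr, ?_, U, hUopen, harcU, lam,
    fun j => ⟨(hlamd j).analyticOnNhd hUopen, Set.eqOn_refl _ _⟩⟩
  · exact exists_perm_of_map_eq isPreconnected_arc ⟨_, neg_one_mem_arc⟩ hfam.1 hlam'.1 hlaminj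
      fun τ hτ => (hlam'.2 τ hτ).symm.trans (hfam.2 τ hτ)
  · have hset : {z | ∃ j, lam j τ = z} = {z | (m - C τ * p).IsRoot z} := by
      ext z
      rw [Set.mem_ofPred_eq, Set.mem_ofPred_eq,
        ← mem_roots (minpoly_sub_degree A u v τ).1.ne_zero, hroots τ hτ]
      simp
    rw [hset]
    exact spectrum_pert_diff hfr (harc0 τ hτ)
  · intro i j hij τ hτ τ' hτ' heq
    have h1 := hlamroot i τ hτ
    have hp := eval_ne_zero_of_isCoprime hcop h1
    have h2 := hlamroot j τ' hτ'
    rw [← heq, h1] at h2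
    -- A common value determines the parameter as m/p, so branches could meet only at equal
    -- parameters.
    have hττ' : τ = τ' := mul_right_cancel₀ hp h2
    subst hττ'
    exact hij (hlaminj τ hτ heq)

theorem norm_Q_ne_one_of_globalAngularEigenvalues {A : Matrix (Fin n) (Fin n) ℂ}
    {u v : Fin n → ℂ} (hglob : GlobalAngularEigenvalues A u v) {z : ℂ}
    (hz : IsCriticalPoint A u v z) (h1 : Q A u v z ≠ 1) : ‖Q A u v z‖ ≠ 1 := by
  intro hn
  obtain ⟨lam, ⟨-, hlam⟩, -, -, hfr, hne, -⟩ := hglob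
  obtain ⟨hzs, hd⟩ := hz
  have hQ : Q A u v z ≠ 0 := norm_ne_zero_iff.1 (by rw [hn]; exact one_ne_zero)
  have hτ : (Q A u v z)⁻¹ ∈ arc := mem_arc_iff.2 ⟨by rw [norm_inv, hn, inv_one], by simpa using h1⟩
  set τ := (Q A u v z)⁻¹ with hτdef
  have hm : (minpoly ℂ A).eval z ≠ 0 := fun h => hzs ((mem_spectrum_iff_isRoot_minpoly A z).2 h)
  rw [deriv_Q A u v hzs, div_eq_zero_iff, or_iff_left (pow_ne_zero 2 hm)] at hd
  have hroot : (minpoly ℂ A).eval z = τ * (pPoly A u v).eval z := by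
    rw [pPoly_eval A u v z hzs, hτdef]
    field_simp
  have hp := eval_ne_zero_of_isCoprime (isCoprime_minpoly_pPoly hfr) hroot
  set P := minpoly ℂ A - C τ * pPoly A u v with hP
  have hP0 : P ≠ 0 := (minpoly_sub_degree A u v τ).1.ne_zero
  have hder : (derivative P).IsRoot z := by
    simp only [wronskian, eval_sub, eval_mul, hroot] at hd
    have h2 : (pPoly A u v).eval z * (τ * (derivative (pPoly A u v)).eval z -
        (derivative (minpoly ℂ A)).eval z) = 0 := by
      rw [← hd]
      ring
    have h3 := (mul_eq_zero.1 h2).resolve_left hp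
    simp only [hP, IsRoot, derivative_sub, derivative_C_mul, eval_sub, eval_mul, eval_C]
    linear_combination -h3
  -- A critical point is a multiple zero of m - τp, whereas disjoint branches list each zero once.
  have hmult : 1 < P.roots.count z := by
    rw [count_roots, one_lt_rootMultiplicity_iff_isRoot hP0]
    exact ⟨(isRoot_minpoly_sub_iff A u v τ z).2 hroot, hder⟩
  have hmap := hlam τ hτ
  rw [newEigenvalues_pert hfr (inv_ne_zero hQ), ← hP] at hmap
  have hnd : P.roots.Nodup := by
    rw [hmap]
    refine Finset.univ.nodup.map fun i j hij => ?_
    by_contra h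
    exact hne i j h τ hτ τ hτ hij
  exact absurd (Multiset.nodup_iff_count_le_one.1 hnd z) (not_le.2 hmult)

end RankOnePerturbation


theorem mainTheorem10 (n : ℕ) (A : Matrix (Fin n) (Fin n) ℂ) :
    -- the generic condition suffices for all conclusions
    (∀ u v : Fin n → ℂ, RankOnePerturbation.GenericCondition A u v →
      RankOnePerturbation.GlobalAngularEigenvalues A u v) ∧
    -- and it is necessary, up to the value `Q(z) = 1`, that is `τ = 1`, which is not in the arc
    (∀ u v : Fin n → ℂ, RankOnePerturbation.GlobalAngularEigenvalues A u v →
      (∀ z : ℂ, ¬ RankOnePerturbation.AccidentallyFrozen A u v z) ∧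
      ∀ z : ℂ, RankOnePerturbation.IsCriticalPoint A u v z →
        RankOnePerturbation.Q A u v z ≠ 1 → ‖RankOnePerturbation.Q A u v z‖ ≠ 1) ∧
    -- for fixed `u`, all of it holds for all `v` outside a closed set with empty interior
    (∀ u : Fin n → ℂ, RankOnePerturbation.HasFullMinpoly A u →
      ∃ E : Set (Fin n → ℂ), IsClosed E ∧ interior E = ∅ ∧
        ∀ v, v ∉ E → RankOnePerturbation.GenericCondition A u v ∧
          RankOnePerturbation.GlobalAngularEigenvalues A u v) ∧
    -- the requirement on `u` holds outside a closed set with empty interior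
    (∃ F : Set (Fin n → ℂ), IsClosed F ∧ interior F = ∅ ∧
      ∀ u, u ∉ F → RankOnePerturbation.HasFullMinpoly A u) ∧
    -- genericity in the pair `(u, v)`
    (∃ G : Set ((Fin n → ℂ) × (Fin n → ℂ)), IsClosed G ∧ interior G = ∅ ∧
      ∀ u v : Fin n → ℂ, (u, v) ∉ G → RankOnePerturbation.GenericCondition A u v ∧
        RankOnePerturbation.GlobalAngularEigenvalues A u v) := by
  open RankOnePerturbation in
  refine ⟨fun u v h => globalAngularEigenvalues_of_genericCondition h,
    fun u v h => ⟨?_, fun z hz h1 => norm_Q_ne_one_of_globalAngularEigenvalues h hz h1⟩,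
    fun u hu => ?_, ?_, ?_⟩
  · obtain ⟨lam, -, -, -, hfr, -⟩ := h
    exact hfr
  · obtain ⟨h1, h2⟩ := isClosed_interior_not_genericCondition A hu
    refine ⟨_, h1, h2, fun v hv => ?_⟩
    have hgen : GenericCondition A u v := not_not.1 hv
    exact ⟨hgen, globalAngularEigenvalues_of_genericCondition hgen⟩
  · obtain ⟨h1, h2⟩ := isClosed_not_hasFullMinpoly A
    exact ⟨_, h1, h2, fun u hu => not_not.1 hu⟩
  · refine ⟨_, isClosed_not_genericCondition A, interior_not_genericCondition A,
      fun u v huv => ?_⟩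
    have hgen : GenericCondition A u v := not_not.1 huv
    exact ⟨hgen, globalAngularEigenvalues_of_genericCondition hgen⟩
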